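/- Let $(X,Y)$ be a pair of discrete random variables with joint distribution $P_{XY}$ on $\{0,1\}\times\mathcal{Y}$ (the single-letter distribution of a stationary memoryless joint source). For a list $\mathcal{P}=\{(\mu_v,\theta_v)\}_{v\in\mathcal{V}}$ of pairs of real numbers put $$M(\mathcal{P})=\sum_{v\in\mathcal{V}}\mu_v|\theta_v|,\qquad H(\mathcal{P})=\sum_{v\in\mathcal{V}}\mu_v\,h\!\left(\frac{1-|\theta_v|}{2}\right),\qquad h(\xi)=-\xi\log_2\xi-(1-\xi)\log_2(1-\xi)$$ (with $0\log_2 0=0$). Let $\mathcal{P}^-$ be the list indexed by $(v_0,v_1)\in\mathcal{V}^2$ with $\mu^-_{v_0,v_1}=\mu_{v_0}\mu_{v_1}$ and $\theta^-_{v_0,v_1}=\theta_{v_0}\theta_{v_1}$. Let $\mathcal{P}^+$ be the list indexed by $(u,v_0,v_1)\in\{0,1\}\times\mathcal{V}^2$ with $$\mu^+_{u,v_0,v_1}=\frac{\mu_{v_0}\mu_{v_1}\left[1+(-1)^u\theta_{v_0}\theta_{v_1}\right]}{2},\qquad \theta^+_{u,v_0,v_1}=\frac{\theta_{v_1}+(-1)^u\theta_{v_0}}{1+(-1)^u\theta_{v_0}\theta_{v_1}},$$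 where $(\mu^+_{u,v_0,v_1},\theta^+_{u,v_0,v_1})=(0,0)$ if $1+(-1)^u\theta_{v_0}\theta_{v_1}=0$. Let $\mathcal{P}=\{(\mu_y,\theta_y)\}_{y\in\mathcal{Y}}$ with $\mu_y=P_Y(y)$ and $\theta_y=P_{X|Y}(0|y)-P_{X|Y}(1|y)$, so that $H(X|Y)=H(\mathcal{P})$ is the conditional entropy in bits. For $b^n=(b_1,\ldots,b_n)\in\{0,1\}^n$ let $\mathcal{P}^{\pm^n}=(\cdots(\mathcal{P}^{\pm_{b_1}})^{\pm_{b_2}}\cdots)^{\pm_{b_n}}$, where $\pm_1$ is $+$ and $\pm_0$ is $-$. For real $\beta$ define $$\mathcal{I}_0=\left\{b^n\in\{0,1\}^n: M(\mathcal{P}^{\pm^n})\ge 1-2^{-2^{n\beta}}\right\},\qquad \mathcal{I}_1=\left\{b^n\in\{0,1\}^n: M(\mathcal{P}^{\pm^n})< 1-2^{-2^{n\beta}}\right\}.$$ Then for every $\beta\in[0,1/2)$ $$\lim_{n\to\infty}\frac{|\mathcal{I}_0|}{2^n}=1-H(X|Y),\qquad \lim_{n\to\infty}\frac{|\mathcal{I}_1|}{2^n}=H(X|Y).$$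 Moreover, $\mathcal{I}_0$ corresponds to the low entropy set and $\mathcal{I}_1$ to the high entropy set, in the following sense: for every $\varepsilon>0$, $$\lim_{n\to\infty}\frac{|\{b^n\in\mathcal{I}_0: H(\mathcal{P}^{\pm^n})\ge\varepsilon\}|}{2^n}=0,\qquad \lim_{n\to\infty}\frac{|\{b^n\in\mathcal{I}_1: H(\mathcal{P}^{\pm^n})\le 1-\varepsilon\}|}{2^n}=0.$$ -/

import Mathlib

open Filter Topology

universe u

noncomputable section

namespace PolarM

/-- The sign `∓_u`: it is `+` for the bit `0` (`false`) and `-` for the bit `1` (`true`). -/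
def mpSign (u : Bool) : ℝ := if u then -1 else 1

/-- A list `𝒫 = {(μ_v, θ_v)}_{v ∈ 𝒱}` of pairs of real numbers, with its index set `𝒱`. -/
structure SymList : Type (u + 1) where
  /-- the index set -/
  V : Type u
  /-- the probability of `v` -/
  μ : V → ℝ
  /-- the difference of the two conditional probabilities of the bit given `v` -/
  θ : V → ℝ

/-- The minus operation:
`μ⁻_{v₀,v₁} = μ_{v₀} μ_{v₁}` and `θ⁻_{v₀,v₁} = θ_{v₀} θ_{v₁}`. -/
def SymList.minus (P : SymList.{u}) : SymList.{u} where
  V := P.V × P.V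
  μ := fun v => P.μ v.1 * P.μ v.2
  θ := fun v => P.θ v.1 * P.θ v.2

/-- The plus operation, indexed by `(u, v₀, v₁)`:
`μ⁺ = μ_{v₀} μ_{v₁} (1 ∓_u θ_{v₀} θ_{v₁}) / 2` and
`θ⁺ = (θ_{v₁} ∓_u θ_{v₀}) / (1 ∓_u θ_{v₀} θ_{v₁})`, with `(μ⁺, θ⁺) = (0, 0)` when
`1 ∓_u θ_{v₀} θ_{v₁} = 0`. -/
def SymList.plus (P : SymList.{u}) : SymList.{u} where
  V := Bool × P.V × P.V
  μ := fun w =>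
    P.μ w.2.1 * P.μ w.2.2 * (1 + mpSign w.1 * (P.θ w.2.1 * P.θ w.2.2)) / 2
  θ := fun w =>
    -- division by zero is `0` here, which is the convention above; `μ` is then `0` as well
    (P.θ w.2.2 + mpSign w.1 * P.θ w.2.1) / (1 + mpSign w.1 * (P.θ w.2.1 * P.θ w.2.2))

/-- `𝒫^{±_b}`, where `±_b` is `+` for `b = 1` and `-` for `b = 0`. -/
def SymList.step (P : SymList.{u}) (b : Bool) : SymList.{u} :=
  if b then P.plus else P.minus

/-- `𝒫^{±_{b₁} ⋯ ±_{b_n}} = (𝒫^{±_{b₁} ⋯ ±_{b_{n-1}}})^{±_{b_n}}`. -/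
def SymList.iter (P : SymList.{u}) : (n : ℕ) → (Fin n → Bool) → SymList.{u}
  | 0, _ => P
  | n + 1, b => (P.iter n (fun i => b i.castSucc)).step (b (Fin.last n))

/-- `M(𝒫) = ∑_v μ_v |θ_v|`. -/
def SymList.M (P : SymList.{u}) : ℝ := ∑' v, P.μ v * |P.θ v|

/-- The binary entropy function `h(ξ) = -ξ log₂ ξ - (1 - ξ) log₂ (1 - ξ)` (with `0 log₂ 0 = 0`). -/
def h (ξ : ℝ) : ℝ := -ξ * Real.logb 2 ξ - (1 - ξ) * Real.logb 2 (1 - ξ)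

/-- `H(𝒫) = ∑_v μ_v h((1 - |θ_v|) / 2)`. -/
def SymList.H (P : SymList.{u}) : ℝ := ∑' v, P.μ v * h ((1 - |P.θ v|) / 2)

/-- The marginal `P_Y(y)` of a joint distribution `P_{XY}` with binary `X`. -/
def probY {Y : Type u} (p : PMF (Bool × Y)) (y : Y) : ℝ := ∑ x : Bool, (p (x, y)).toReal

/-- The conditional probability `P_{X|Y}(x|y)` (equal to `0` when `P_Y(y) = 0`). -/
def condProb {Y : Type u} (p : PMF (Bool × Y)) (x : Bool) (y : Y) : ℝ :=
  (p (x, y)).toReal / probY p y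

/-- The list `𝒫(X|Y)`: `μ_y = P_Y(y)` and `θ_y = P_{X|Y}(0|y) - P_{X|Y}(1|y)`. -/
def sourceList {Y : Type u} (p : PMF (Bool × Y)) : SymList.{u} where
  V := Y
  μ := fun y => probY p y
  θ := fun y => condProb p false y - condProb p true y

/-- The conditional entropy `H(X|Y) = ∑_y P_Y(y) h((1 - |θ_y|) / 2)`, in bits. -/
def condEntropy {Y : Type u} (p : PMF (Bool × Y)) : ℝ := (sourceList p).H

/-- `𝓘₀`: the indices `bⁿ` with `M(𝒫^{±ⁿ}) ≥ 1 - 2^{-2^{nβ}}`. -/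
def I0 {Y : Type u} (p : PMF (Bool × Y)) (β : ℝ) (n : ℕ) : Set (Fin n → Bool) :=
  {b | 1 - (2 : ℝ) ^ (-(2 : ℝ) ^ ((n : ℝ) * β)) ≤ ((sourceList p).iter n b).M}

/-- `𝓘₁`: the indices `bⁿ` with `M(𝒫^{±ⁿ}) < 1 - 2^{-2^{nβ}}`. -/
def I1 {Y : Type u} (p : PMF (Bool × Y)) (β : ℝ) (n : ℕ) : Set (Fin n → Bool) :=
  {b | ((sourceList p).iter n b).M < 1 - (2 : ℝ) ^ (-(2 : ℝ) ^ ((n : ℝ) * β))}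

end PolarM

end

/-! Choose the bits uniformly at random and follow the random list they generate. Three functionals
control it. The entropy `H` is a martingale (chain rule: `H⁻ + H⁺ = 2H`). For `M` there is `M⁻ = M²`
and `M⁺ ≤ 2M - M²`, so it is a supermartingale. The Bhattacharyya parameter satisfies `Z⁺ = Z²` and
`Z⁻ ≤ 2Z - Z²`.

Polarization: the bounded potential `2M - M²` drops on average by at least `(M - M²)²` per step, so
the mean of `(M - M²)²` tends to zero and `M` ends near `0` or `1`. As `1 - M ≤ H ≤ ε + c(1 - M)`,
this means `H` near `1` or `0`.

Rate: it remains to exclude `1/2 < M < 1 - 2^{-2^{nβ}}`. After a fixed number of steps `M` is mostly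
near `0` or `1`. From near `0`, Markov's inequality makes exceeding `1/2` unlikely. From near `1`,
`Z` is small; while it stays small, `-log₂ Z` doubles on a plus step and loses only a small
proportion on a minus step, so for `β < 1/2` it exceeds `2^{nβ}` with high probability, and `1 - M ≤
Z` transfers this to `M` (`stepAvg_pow_ind_Z_gt_le`, `tendsto_stepAvg_pow_ind_slow`).

Hence `H` is within `ε` of the indicator of the high entropy set outside a vanishing fraction of
sequences, and conservation of the mean of `H` identifies the limits. -/

noncomputable section
namespace PolarM

/-! ### Means over a list and over pairs of its entries -/

/-- The mean of `f(θ_v)` under the weights `μ_v`. -/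
def SymList.mean (P : SymList.{u}) (f : ℝ → ℝ) : ℝ := ∑' v, P.μ v * f (P.θ v)

/-- The mean of `g(θ_{v₀}, θ_{v₁})` under the product weights `μ_{v₀} μ_{v₁}`. -/
def SymList.mean₂ (P : SymList.{u}) (g : ℝ → ℝ → ℝ) : ℝ :=
  ∑' v : P.V × P.V, P.μ v.1 * P.μ v.2 * g (P.θ v.1) (P.θ v.2)

/-- A list that comes from a joint distribution: the weights form a probability distribution and
`|θ_v| ≤ 1`. -/
structure SymList.IsProb (P : SymList.{u}) : Prop where
  nonneg : ∀ v, 0 ≤ P.μ v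
  hasSum : HasSum P.μ 1
  abs_le : ∀ v, |P.θ v| ≤ 1

namespace SymList.IsProb

variable {P : SymList.{u}} {f g : ℝ → ℝ} {F G : ℝ → ℝ → ℝ} {C D : ℝ}

lemma summable (hP : P.IsProb) (hf : ∀ x, |x| ≤ 1 → |f x| ≤ C) :
    Summable fun v => P.μ v * f (P.θ v) := by
  refine Summable.of_norm_bounded (hP.hasSum.summable.mul_right C) fun v => ?_
  rw [Real.norm_eq_abs, abs_mul, abs_of_nonneg (hP.nonneg v)]
  exact mul_le_mul_of_nonneg_left (hf _ (hP.abs_le v)) (hP.nonneg v)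

lemma hasSum_mul (hP : P.IsProb) : HasSum (fun v : P.V × P.V => P.μ v.1 * P.μ v.2) 1 := by
  have hs : Summable fun v => ‖P.μ v‖ := hP.hasSum.summable.norm
  have h1 := summable_mul_of_summable_norm hs hs
  have h2 := tsum_mul_tsum_of_summable_norm hs hs
  rw [hP.hasSum.tsum_eq, one_mul] at h2
  exact h2 ▸ h1.hasSum

lemma summable₂ (hP : P.IsProb) (hF : ∀ x y, |x| ≤ 1 → |y| ≤ 1 → |F x y| ≤ C) :
    Summable fun v : P.V × P.V => P.μ v.1 * P.μ v.2 * F (P.θ v.1) (P.θ v.2) := by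
  refine Summable.of_norm_bounded (hP.hasSum_mul.summable.mul_right C) fun v => ?_
  have h0 := mul_nonneg (hP.nonneg v.1) (hP.nonneg v.2)
  rw [Real.norm_eq_abs, abs_mul, abs_of_nonneg h0]
  exact mul_le_mul_of_nonneg_left (hF _ _ (hP.abs_le _) (hP.abs_le _)) h0

lemma mean_mono (hP : P.IsProb) (hf : ∀ x, |x| ≤ 1 → |f x| ≤ C) (hg : ∀ x, |x| ≤ 1 → |g x| ≤ D)
    (hfg : ∀ x, |x| ≤ 1 → f x ≤ g x) : P.mean f ≤ P.mean g :=
  (hP.summable hf).tsum_le_tsum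
    (fun v => mul_le_mul_of_nonneg_left (hfg _ (hP.abs_le v)) (hP.nonneg v)) (hP.summable hg)

lemma mean₂_mono (hP : P.IsProb) (hF : ∀ x y, |x| ≤ 1 → |y| ≤ 1 → |F x y| ≤ C)
    (hG : ∀ x y, |x| ≤ 1 → |y| ≤ 1 → |G x y| ≤ D)
    (hFG : ∀ x y, |x| ≤ 1 → |y| ≤ 1 → F x y ≤ G x y) : P.mean₂ F ≤ P.mean₂ G :=
  (hP.summable₂ hF).tsum_le_tsum
    (fun _ => mul_le_mul_of_nonneg_left (hFG _ _ (hP.abs_le _) (hP.abs_le _))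
      (mul_nonneg (hP.nonneg _) (hP.nonneg _))) (hP.summable₂ hG)

lemma mean₂_congr (hP : P.IsProb) (hFG : ∀ x y, |x| ≤ 1 → |y| ≤ 1 → F x y = G x y) :
    P.mean₂ F = P.mean₂ G :=
  tsum_congr fun v => by rw [hFG _ _ (hP.abs_le _) (hP.abs_le _)]

lemma mean_const_add_mul (hP : P.IsProb) (hf : ∀ x, |x| ≤ 1 → |f x| ≤ C) (a b : ℝ) :
    P.mean (fun x => a + b * f x) = a + b * P.mean f := by
  have h := (hP.hasSum.mul_right a).add ((hP.summable hf).hasSum.mul_left b)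
  rw [one_mul] at h
  rw [mean, mean, ← h.tsum_eq]
  exact tsum_congr fun v => by ring

lemma mean₂_add (hP : P.IsProb) (hF : ∀ x y, |x| ≤ 1 → |y| ≤ 1 → |F x y| ≤ C)
    (hG : ∀ x y, |x| ≤ 1 → |y| ≤ 1 → |G x y| ≤ D) :
    P.mean₂ (fun x y => F x y + G x y) = P.mean₂ F + P.mean₂ G := by
  rw [mean₂, mean₂, mean₂, ← (hP.summable₂ hF).tsum_add (hP.summable₂ hG)]
  exact tsum_congr fun v => by ring

lemma mean₂_mul (hP : P.IsProb) (hf : ∀ x, |x| ≤ 1 → |f x| ≤ C)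
    (hg : ∀ x, |x| ≤ 1 → |g x| ≤ D) :
    P.mean₂ (fun x y => f x * g y) = P.mean f * P.mean g := by
  rw [mean, mean, tsum_mul_tsum_of_summable_norm (hP.summable hf).norm (hP.summable hg).norm]
  exact tsum_congr fun v => by ring

lemma mean_one (hP : P.IsProb) : P.mean (fun _ => 1) = 1 := by
  simpa [mean] using hP.hasSum.tsum_eq

lemma mean₂_left (hP : P.IsProb) (hf : ∀ x, |x| ≤ 1 → |f x| ≤ C) :
    P.mean₂ (fun x _ => f x) = P.mean f := by
  simpa [hP.mean_one] using hP.mean₂_mul hf (g := fun _ => 1) (D := 1) (by simp)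

lemma mean₂_right (hP : P.IsProb) (hf : ∀ x, |x| ≤ 1 → |f x| ≤ C) :
    P.mean₂ (fun _ y => f y) = P.mean f := by
  simpa [hP.mean_one] using hP.mean₂_mul (f := fun _ => 1) (C := 1) (by simp) hf

lemma minus (hP : P.IsProb) : P.minus.IsProb where
  nonneg v := mul_nonneg (hP.nonneg _) (hP.nonneg _)
  hasSum := hP.hasSum_mul
  abs_le v := by
    simp only [SymList.minus, abs_mul]
    exact mul_le_one₀ (hP.abs_le _) (abs_nonneg _) (hP.abs_le _)

end SymList.IsProb

lemma mul_mem_Icc {x y : ℝ} (hx : |x| ≤ 1) (hy : |y| ≤ 1) : -1 ≤ x * y ∧ x * y ≤ 1 := by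
  rw [← abs_le, abs_mul]
  exact mul_le_one₀ hx (abs_nonneg _) hy

lemma abs_add_div_le_one {x y : ℝ} (hx : |x| ≤ 1) (hy : |y| ≤ 1) :
    |(y + x) / (1 + x * y)| ≤ 1 := by
  have h := mul_mem_Icc hx hy
  rw [abs_le] at hx hy
  rw [abs_div]
  refine div_le_one_of_le₀ ?_ (abs_nonneg _)
  rw [abs_of_nonneg (show 0 ≤ 1 + x * y by linarith), abs_le]
  constructor <;> nlinarith

/-! ### The plus operation as a kernel on pairs -/

/-- The mean after the plus operation, as a mean over the pairs `(θ_{v₀}, θ_{v₁})`. -/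
def plusKernel (f : ℝ → ℝ) (x y : ℝ) : ℝ :=
  ((1 + x * y) * f ((y + x) / (1 + x * y)) + (1 - x * y) * f ((y - x) / (1 - x * y))) / 2

lemma abs_plusKernel_le {f : ℝ → ℝ} {C : ℝ} (hf : ∀ x, |x| ≤ 1 → |f x| ≤ C) (x y : ℝ)
    (hx : |x| ≤ 1) (hy : |y| ≤ 1) : |plusKernel f x y| ≤ C := by
  have h := mul_mem_Icc hx hy
  have h1 := abs_le.1 (hf _ (abs_add_div_le_one hx hy))
  have h2 := abs_le.1 (hf _ (abs_add_div_le_one (x := -x) (by simpa using hx) hy))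
  have e1 : y + -x = y - x := by ring
  have e2 : 1 + -x * y = 1 - x * y := by ring
  rw [e1, e2] at h2
  rw [plusKernel, abs_le]
  constructor <;> nlinarith

lemma hasSum_bool_prod {W : Type*} {F : Bool × W → ℝ} {a b : ℝ}
    (ha : HasSum (fun w => F (false, w)) a) (hb : HasSum (fun w => F (true, w)) b) :
    HasSum F (a + b) := by
  rw [← (Equiv.boolProdEquivSum W).symm.hasSum_iff]
  exact HasSum.sum ha hb

namespace SymList.IsProb

variable {P : SymList.{u}} {f : ℝ → ℝ} {C : ℝ}

lemma hasSum_plus (hP : P.IsProb) (hf : ∀ x, |x| ≤ 1 → |f x| ≤ C) :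
    HasSum (fun v => P.plus.μ v * f (P.plus.θ v)) (P.mean₂ (plusKernel f)) := by
  have key (s : ℝ) (hs : |s| = 1) (x y : ℝ) (hx : |x| ≤ 1) (hy : |y| ≤ 1) :
      |(1 + s * (x * y)) / 2 * f ((y + s * x) / (1 + s * (x * y)))| ≤ C := by
    have hsx : |s * x| ≤ 1 := by rwa [abs_mul, hs, one_mul]
    have h1 := hf _ (abs_add_div_le_one hsx hy)
    have h2 := mul_mem_Icc hsx hy
    rw [mul_assoc] at h1 h2
    rw [abs_mul, abs_of_nonneg (by linarith)]
    have h3 := abs_nonneg (f ((y + s * x) / (1 + s * (x * y))))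
    nlinarith
  have h1 := hP.summable₂ (F := fun x y =>
    (1 + 1 * (x * y)) / 2 * f ((y + 1 * x) / (1 + 1 * (x * y)))) (key 1 (by simp))
  have h2 := hP.summable₂ (F := fun x y =>
    (1 + -1 * (x * y)) / 2 * f ((y + -1 * x) / (1 + -1 * (x * y)))) (key (-1) (by simp))
  have h3 := h1.tsum_add h2
  have h4 : P.mean₂ (plusKernel f) = _ := (tsum_congr fun v => ?_).trans h3
  · rw [h4]
    refine hasSum_bool_prod ?_ ?_
    · convert h1.hasSum using 2 with v
      simp only [SymList.plus, mpSign]; simp; ring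
    · convert h2.hasSum using 2 with v
      simp only [SymList.plus, mpSign]; simp; ring
  · simp only [plusKernel, one_mul, neg_one_mul, ← sub_eq_add_neg]; ring

lemma plus (hP : P.IsProb) : P.plus.IsProb where
  nonneg v := by
    have h := mul_mem_Icc (hP.abs_le v.2.1) (hP.abs_le v.2.2)
    have h0 := mul_nonneg (hP.nonneg v.2.1) (hP.nonneg v.2.2)
    simp only [SymList.plus, mpSign]
    split_ifs <;> refine div_nonneg (mul_nonneg h0 ?_) (by norm_num) <;> linarith
  hasSum := by
    have h := hP.hasSum_plus (f := fun _ => 1) (C := 1) (by simp)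
    have e : plusKernel (fun _ => 1) = fun _ _ => 1 := by
      ext x y; simp only [plusKernel]; ring
    rw [e, hP.mean₂_left (f := fun _ => 1) (C := 1) (by simp), hP.mean_one] at h
    simpa using h
  abs_le v := by
    have h : |mpSign v.1 * P.θ v.2.1| ≤ 1 := by
      have : |mpSign v.1| = 1 := by unfold mpSign; split_ifs <;> simp
      rw [abs_mul, this, one_mul]
      exact hP.abs_le _
    have h1 := abs_add_div_le_one h (hP.abs_le v.2.2)
    rwa [mul_assoc] at h1

lemma mean_plus (hP : P.IsProb) (hf : ∀ x, |x| ≤ 1 → |f x| ≤ C) :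
    P.plus.mean f = P.mean₂ (plusKernel f) :=
  (hP.hasSum_plus hf).tsum_eq

end SymList.IsProb

/-! ### Pointwise identities and inequalities for entropy, bias and Bhattacharyya terms -/

/-- The Bhattacharyya parameter `Z(𝒫) = ∑_v μ_v √(1 - θ_v²)`. -/
def SymList.Z (P : SymList.{u}) : ℝ := P.mean fun x => √(1 - x ^ 2)

lemma abs_abs_le_one (x : ℝ) (hx : |x| ≤ 1) : |(|x|)| ≤ 1 := by simpa using hx

lemma one_sub_sq_nonneg {x : ℝ} (hx : |x| ≤ 1) : 0 ≤ 1 - x ^ 2 := by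
  have := (sq_le_one_iff_abs_le_one x).2 hx
  linarith

lemma abs_sqrt_le_one (x : ℝ) (_ : |x| ≤ 1) : |√(1 - x ^ 2)| ≤ 1 := by
  rw [abs_of_nonneg (Real.sqrt_nonneg _), Real.sqrt_le_one]
  linarith [sq_nonneg x]

lemma h_eq_binEntropy (x : ℝ) : h x = Real.binEntropy x / Real.log 2 := by
  rw [Real.binEntropy_eq_negMulLog_add_negMulLog_one_sub, h, Real.logb, Real.logb,
    Real.negMulLog, Real.negMulLog]
  ring

lemma h_nonneg {x : ℝ} (h0 : 0 ≤ x) (h1 : x ≤ 1) : 0 ≤ h x := by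
  rw [h_eq_binEntropy]
  exact div_nonneg (Real.binEntropy_nonneg h0 h1) (Real.log_nonneg (by norm_num))

lemma h_le_one (x : ℝ) : h x ≤ 1 := by
  rw [h_eq_binEntropy]
  exact div_le_one_of_le₀ Real.binEntropy_le_log_two (Real.log_nonneg (by norm_num))

/-- By concavity the graph lies above its chord from `0` to `1/2`. -/
lemma two_mul_le_h {x : ℝ} (h0 : 0 ≤ x) (h1 : x ≤ 1 / 2) : 2 * x ≤ h x := by
  have hl : 0 < Real.log 2 := Real.log_pos (by norm_num)
  have := Real.strictConcave_binEntropy.concaveOn.2 (x := 0) (y := 2⁻¹) (by simp)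
    (by constructor <;> norm_num) (show 0 ≤ 1 - 2 * x by linarith)
    (show 0 ≤ 2 * x by linarith) (by ring)
  simp only [Real.binEntropy_zero, Real.binEntropy_two_inv, smul_eq_mul, mul_zero, zero_add] at this
  rw [h_eq_binEntropy, le_div_iff₀ hl]
  convert this using 2
  ring

/-- Continuity at `0` handles `x < δ`; beyond that `x / δ ≥ 1 ≥ h x`. A bound affine in `x` passes
directly to means. -/
lemma h_le_add_mul {ε : ℝ} (hε : 0 < ε) : ∃ c, 0 < c ∧ ∀ x, 0 ≤ x → h x ≤ ε + c * x := by
  have hc : Continuous h := by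
    have : h = fun x => Real.binEntropy x / Real.log 2 := funext h_eq_binEntropy
    rw [this]; fun_prop
  obtain ⟨δ, hδ, H⟩ := Metric.continuousAt_iff.1 (hc.continuousAt (x := 0)) ε hε
  have h0 : h 0 = 0 := by simp [h]
  refine ⟨1 / δ, by positivity, fun x hx => ?_⟩
  rcases lt_or_ge x δ with hlt | hge
  · have := H (x := x) (by simpa [abs_of_nonneg hx] using hlt)
    rw [h0, Real.dist_eq, sub_zero, abs_lt] at this
    have : 0 ≤ 1 / δ * x := by positivity
    linarith
  · have h1 : 1 ≤ 1 / δ * x := by rw [one_div_mul_eq_div, le_div_iff₀ hδ]; linarith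
    linarith [h_le_one x]

/-- The entropy of a bit with bias `x`. -/
def biasEntropy (x : ℝ) : ℝ := h ((1 - |x|) / 2)

lemma biasEntropy_nonneg {x : ℝ} (hx : |x| ≤ 1) : 0 ≤ biasEntropy x :=
  h_nonneg (by linarith) (by linarith [abs_nonneg x])

lemma abs_biasEntropy_le_one (x : ℝ) (hx : |x| ≤ 1) : |biasEntropy x| ≤ 1 := by
  rw [abs_of_nonneg (biasEntropy_nonneg hx)]
  exact h_le_one _

lemma biasEntropy_eq {x : ℝ} :
    biasEntropy x = 1 + (Real.negMulLog (1 - x) + Real.negMulLog (1 + x)) / (2 * Real.log 2) := by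
  have hl : 0 < Real.log 2 := Real.log_pos (by norm_num)
  have e : biasEntropy x = h ((1 - x) / 2) := by
    rcases abs_choice x with hx | hx
    · rw [biasEntropy, hx]
    · rw [biasEntropy, hx, h_eq_binEntropy, h_eq_binEntropy, ← Real.binEntropy_one_sub]
      congr 2; ring
  have e2 (y : ℝ) : Real.negMulLog (y / 2) = (Real.negMulLog y + y * Real.log 2) / 2 := by
    rw [div_eq_mul_inv, Real.negMulLog_mul, Real.negMulLog, Real.negMulLog, Real.log_inv]; ring
  rw [e, h_eq_binEntropy, Real.binEntropy_eq_negMulLog_add_negMulLog_one_sub,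
    show 1 - (1 - x) / 2 = (1 + x) / 2 by ring, e2, e2]
  field_simp
  ring

/-- Clears the denominator of the plus operation. The hypothesis covers `w = 0`, where the quotient
takes the default value `0`. -/
lemma mul_biasEntropy_div {w c : ℝ} (hc : w = 0 → c = 0) :
    w * biasEntropy (c / w) = w +
      (Real.negMulLog (w - c) + Real.negMulLog (w + c) - 2 * Real.negMulLog w) /
        (2 * Real.log 2) := by
  rcases eq_or_ne w 0 with rfl | hw
  · simp [hc rfl]
  have e1 : Real.negMulLog (w - c) =
      (1 - c / w) * Real.negMulLog w + w * Real.negMulLog (1 - c / w) := by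
    rw [← Real.negMulLog_mul]; congr 1; field_simp
  have e2 : Real.negMulLog (w + c) =
      (1 + c / w) * Real.negMulLog w + w * Real.negMulLog (1 + c / w) := by
    rw [← Real.negMulLog_mul]; congr 1; field_simp
  rw [biasEntropy_eq, e1, e2]
  ring

/-- Here `x² + y² ≤ 2 = -2xy`, so `(x + y)² ≤ 0`. -/
lemma add_eq_zero_of_mul_eq_neg_one {x y : ℝ} (hx : |x| ≤ 1) (hy : |y| ≤ 1)
    (h : 1 + x * y = 0) : y + x = 0 := by
  have h1 := one_sub_sq_nonneg hx
  have h2 := one_sub_sq_nonneg hy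
  nlinarith [sq_nonneg (y + x)]

/-- The chain rule in pointwise form. The four joint weights factor, for example `1 + xy + (y + x) =
(1 + x)(1 + y)`, and the product rule for `negMulLog` splits their entropies. -/
lemma biasEntropy_add_plusKernel {x y : ℝ} (hx : |x| ≤ 1) (hy : |y| ≤ 1) :
    biasEntropy (x * y) + plusKernel biasEntropy x y = biasEntropy x + biasEntropy y := by
  have h1 := mul_biasEntropy_div (add_eq_zero_of_mul_eq_neg_one hx hy)
  have h2 := mul_biasEntropy_div
    (add_eq_zero_of_mul_eq_neg_one (x := -x) (by simpa using hx) hy)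
  rw [show 1 + -x * y = 1 - x * y by ring, ← sub_eq_add_neg] at h2
  rw [plusKernel, h1, h2, show 1 + x * y - (y + x) = (1 - x) * (1 - y) by ring,
    show 1 + x * y + (y + x) = (1 + x) * (1 + y) by ring,
    show 1 - x * y - (y - x) = (1 + x) * (1 - y) by ring,
    show 1 - x * y + (y - x) = (1 - x) * (1 + y) by ring]
  simp only [Real.negMulLog_mul, biasEntropy_eq]
  ring

/-- After clearing denominators, `|y + x| + |y - x| = 2 max(|x|, |y|)`, and `max(a, b) ≤ 1 - (1 -
a)(1 - b)` on `[0, 1]`. -/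
lemma plusKernel_abs_le {x y : ℝ} (hx : |x| ≤ 1) (hy : |y| ≤ 1) :
    plusKernel (fun t => |t|) x y ≤ |x| + |y| - |x| * |y| := by
  have key (w c : ℝ) (hw : 0 ≤ w) : w * |c / w| ≤ |c| := by
    rcases hw.eq_or_lt with rfl | hw
    · simp
    · rw [abs_div, abs_of_pos hw, mul_div_cancel₀ _ hw.ne']
  have h := mul_mem_Icc hx hy
  have h1 := key (1 + x * y) (y + x) (by linarith)
  have h2 := key (1 - x * y) (y - x) (by linarith)
  have h3 : |y + x| + |y - x| ≤ 2 * max |x| |y| := by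
    have a1 := le_max_left |x| |y|
    have a2 := le_max_right |x| |y|
    rw [abs_le] at a1 a2
    rcases abs_cases (y + x) with h | h <;> rcases abs_cases (y - x) with h' | h' <;> linarith
  have h4 : max |x| |y| ≤ |x| + |y| - |x| * |y| :=
    max_le (by nlinarith [abs_nonneg x, abs_nonneg y]) (by nlinarith [abs_nonneg x, abs_nonneg y])
  rw [plusKernel]
  linarith

/-- Both signs give the same value, since `(1 ± xy)² - (y ± x)² = (1 - x²)(1 - y²)`. -/
lemma plusKernel_sqrt {x y : ℝ} (hx : |x| ≤ 1) (hy : |y| ≤ 1) :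
    plusKernel (fun t => √(1 - t ^ 2)) x y = √(1 - x ^ 2) * √(1 - y ^ 2) := by
  have key (w c : ℝ) (hw : 0 ≤ w) : w * √(1 - (c / w) ^ 2) = √(w ^ 2 - c ^ 2) := by
    rcases hw.eq_or_lt with rfl | hw
    · rw [zero_mul, Real.sqrt_eq_zero_of_nonpos]
      nlinarith [sq_nonneg c]
    · nth_rw 1 [← Real.sqrt_sq hw.le]
      rw [← Real.sqrt_mul (sq_nonneg w)]
      congr 1; field_simp
  have h := mul_mem_Icc hx hy
  rw [plusKernel, key _ _ (by linarith), key _ _ (by linarith),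
    ← Real.sqrt_mul (one_sub_sq_nonneg hx),
    show (1 + x * y) ^ 2 - (y + x) ^ 2 = (1 - x ^ 2) * (1 - y ^ 2) by ring,
    show (1 - x * y) ^ 2 - (y - x) ^ 2 = (1 - x ^ 2) * (1 - y ^ 2) by ring]
  ring

lemma sqrt_one_sub_mul_sq_le {x y : ℝ} (hx : |x| ≤ 1) (hy : |y| ≤ 1) :
    √(1 - (x * y) ^ 2) + √(1 - x ^ 2) * √(1 - y ^ 2) ≤ √(1 - x ^ 2) + √(1 - y ^ 2) := by
  have ha := Real.sq_sqrt (one_sub_sq_nonneg hx)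
  have hb := Real.sq_sqrt (one_sub_sq_nonneg hy)
  have ha1 := (abs_le.1 (abs_sqrt_le_one x hx)).2
  have hb1 := (abs_le.1 (abs_sqrt_le_one y hy)).2
  have ha0 := Real.sqrt_nonneg (1 - x ^ 2)
  have hb0 := Real.sqrt_nonneg (1 - y ^ 2)
  generalize √(1 - x ^ 2) = a at *
  generalize √(1 - y ^ 2) = b at *
  have : √(1 - (x * y) ^ 2) ≤ a + b - a * b := by
    refine Real.sqrt_le_iff.2 ⟨by nlinarith, ?_⟩
    rw [mul_pow, show x ^ 2 = 1 - a ^ 2 by linarith, show y ^ 2 = 1 - b ^ 2 by linarith]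
    -- The difference of the two sides is `2ab(1 - a)(1 - b)`.
    nlinarith [mul_nonneg (mul_nonneg ha0 hb0) (mul_nonneg (sub_nonneg.2 ha1) (sub_nonneg.2 hb1))]
  linarith

/-! ### One-step relations and comparisons for `M`, `Z` and `H` -/

namespace SymList.IsProb

variable {P : SymList.{u}}

lemma M_nonneg (hP : P.IsProb) : 0 ≤ P.M :=
  tsum_nonneg fun v => mul_nonneg (hP.nonneg v) (abs_nonneg _)

lemma M_le_one (hP : P.IsProb) : P.M ≤ 1 := by
  have := hP.mean_mono abs_abs_le_one (g := fun _ => 1) (D := 1) (by simp) fun x hx => hx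
  rwa [hP.mean_one] at this

lemma H_nonneg (hP : P.IsProb) : 0 ≤ P.H :=
  tsum_nonneg fun v => mul_nonneg (hP.nonneg v) (biasEntropy_nonneg (hP.abs_le v))

lemma H_le_one (hP : P.IsProb) : P.H ≤ 1 := by
  have := hP.mean_mono abs_biasEntropy_le_one (g := fun _ => 1) (D := 1) (by simp)
    fun x _ => h_le_one _
  rwa [hP.mean_one] at this

lemma Z_nonneg (hP : P.IsProb) : 0 ≤ P.Z :=
  tsum_nonneg fun v => mul_nonneg (hP.nonneg v) (Real.sqrt_nonneg _)

lemma M_minus (hP : P.IsProb) : P.minus.M = P.M ^ 2 := by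
  have h1 : P.minus.M = P.mean₂ fun x y => |x| * |y| := by simp_rw [← abs_mul]; rfl
  rw [h1, hP.mean₂_mul abs_abs_le_one abs_abs_le_one, sq]; rfl

lemma M_plus_le (hP : P.IsProb) : P.plus.M ≤ 2 * P.M - P.M ^ 2 := by
  have hb1 : ∀ x y : ℝ, |x| ≤ 1 → |y| ≤ 1 → |(|x| * |y|)| ≤ 1 := fun x y hx hy => by
    rw [abs_mul, abs_abs, abs_abs]; exact mul_le_one₀ hx (abs_nonneg _) hy
  have hb2 : ∀ x y : ℝ, |x| ≤ 1 → |y| ≤ 1 → |(|x| + |y|)| ≤ 2 := fun x y hx hy => by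
    rw [abs_of_nonneg (by positivity)]; linarith
  have h1 := hP.mean₂_add (abs_plusKernel_le abs_abs_le_one) hb1
  have h2 : P.mean₂ (fun x y => plusKernel (fun t => |t|) x y + |x| * |y|) ≤
      P.mean₂ fun x y => |x| + |y| := by
    refine hP.mean₂_mono (C := 2) (fun x y hx hy => (abs_add_le _ _).trans ?_) hb2
      fun x y hx hy => by linarith [plusKernel_abs_le hx hy]
    linarith [abs_plusKernel_le abs_abs_le_one x y hx hy, hb1 x y hx hy]
  rw [h1, hP.mean₂_mul abs_abs_le_one abs_abs_le_one,
    hP.mean₂_add (F := fun x _ => |x|) (G := fun _ y => |y|) (fun x _ hx _ => abs_abs_le_one x hx)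
      (fun _ y _ hy => abs_abs_le_one y hy), hP.mean₂_left abs_abs_le_one,
    hP.mean₂_right abs_abs_le_one, ← hP.mean_plus abs_abs_le_one] at h2
  change P.plus.M + P.M * P.M ≤ P.M + P.M at h2
  linarith

lemma Z_plus (hP : P.IsProb) : P.plus.Z = P.Z ^ 2 := by
  rw [Z, hP.mean_plus abs_sqrt_le_one, hP.mean₂_congr fun x y => plusKernel_sqrt,
    hP.mean₂_mul abs_sqrt_le_one abs_sqrt_le_one, sq]; rfl

lemma Z_minus_add_sq_le (hP : P.IsProb) : P.minus.Z + P.Z ^ 2 ≤ 2 * P.Z := by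
  have hb0 : ∀ x y : ℝ, |x| ≤ 1 → |y| ≤ 1 → |√(1 - (x * y) ^ 2)| ≤ 1 := fun x y hx hy =>
    abs_sqrt_le_one _ (_root_.abs_le.2 (mul_mem_Icc hx hy))
  have hb1 : ∀ x y : ℝ, |x| ≤ 1 → |y| ≤ 1 → |√(1 - x ^ 2) * √(1 - y ^ 2)| ≤ 1 :=
    fun x y hx hy => by
      rw [abs_mul]
      exact mul_le_one₀ (abs_sqrt_le_one x hx) (abs_nonneg _) (abs_sqrt_le_one y hy)
  have hb2 : ∀ x y : ℝ, |x| ≤ 1 → |y| ≤ 1 → |√(1 - x ^ 2) + √(1 - y ^ 2)| ≤ 2 :=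
    fun x y hx hy => (abs_add_le _ _).trans (by
      linarith [abs_sqrt_le_one x hx, abs_sqrt_le_one y hy])
  have h2 : P.mean₂ (fun x y => √(1 - (x * y) ^ 2) + √(1 - x ^ 2) * √(1 - y ^ 2)) ≤
      P.mean₂ fun x y => √(1 - x ^ 2) + √(1 - y ^ 2) :=
    hP.mean₂_mono (C := 2) (fun x y hx hy => (abs_add_le _ _).trans (by
      linarith [hb0 x y hx hy, hb1 x y hx hy])) hb2 fun x y => sqrt_one_sub_mul_sq_le
  rw [hP.mean₂_add hb0 hb1, hP.mean₂_mul abs_sqrt_le_one abs_sqrt_le_one,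
    hP.mean₂_add (F := fun x _ => √(1 - x ^ 2)) (G := fun _ y => √(1 - y ^ 2))
      (fun x _ hx _ => abs_sqrt_le_one x hx) (fun _ y _ hy => abs_sqrt_le_one y hy),
    hP.mean₂_left abs_sqrt_le_one, hP.mean₂_right abs_sqrt_le_one] at h2
  change P.minus.Z + P.Z * P.Z ≤ P.Z + P.Z at h2
  linarith

lemma H_minus_add_H_plus (hP : P.IsProb) : P.minus.H + P.plus.H = 2 * P.H := by
  have h1 : P.minus.H = P.mean₂ fun x y => biasEntropy (x * y) := rfl
  have h2 : P.plus.H = P.plus.mean biasEntropy := rfl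
  have h3 : P.H = P.mean biasEntropy := rfl
  rw [h1, h2, hP.mean_plus abs_biasEntropy_le_one, ← hP.mean₂_add
    (fun x y hx hy => abs_biasEntropy_le_one _ (_root_.abs_le.2 (mul_mem_Icc hx hy)))
    (abs_plusKernel_le abs_biasEntropy_le_one),
    hP.mean₂_congr fun x y => biasEntropy_add_plusKernel,
    hP.mean₂_add (F := fun x _ => biasEntropy x) (G := fun _ y => biasEntropy y)
      (fun x _ hx _ => abs_biasEntropy_le_one x hx) (fun _ y _ hy => abs_biasEntropy_le_one y hy),
    hP.mean₂_left abs_biasEntropy_le_one, hP.mean₂_right abs_biasEntropy_le_one, h3]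
  ring

lemma mean_affine_abs (hP : P.IsProb) (a b : ℝ) : P.mean (fun x => a + b * |x|) = a + b * P.M :=
  hP.mean_const_add_mul abs_abs_le_one a b

lemma abs_affine_le (a b x : ℝ) (hx : |x| ≤ 1) : |(a + b * |x|)| ≤ |a| + |b| := by
  refine (abs_add_le _ _).trans ?_
  rw [abs_mul, abs_abs]
  nlinarith [abs_nonneg b]

lemma one_sub_M_le_H (hP : P.IsProb) : 1 - P.M ≤ P.H := by
  have := hP.mean_mono (f := fun x => 1 + -1 * |x|) (abs_affine_le 1 (-1))
    abs_biasEntropy_le_one fun x hx => by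
    have := two_mul_le_h (x := (1 - |x|) / 2) (by linarith) (by linarith [abs_nonneg x])
    change _ ≤ h _
    linarith
  rw [hP.mean_affine_abs] at this
  change _ ≤ P.H at this
  linarith

lemma one_sub_M_le_Z (hP : P.IsProb) : 1 - P.M ≤ P.Z := by
  have := hP.mean_mono (f := fun x => 1 + -1 * |x|) (abs_affine_le 1 (-1))
    abs_sqrt_le_one fun x hx => by
    refine Real.le_sqrt_of_sq_le ?_
    rw [← sq_abs x]
    nlinarith [abs_nonneg x]
  rw [hP.mean_affine_abs] at this
  change _ ≤ P.Z at this
  linarith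

/-- An AM-GM type bound, affine in `|θ|` so that averaging produces `M`; `c` is tuned later to the
order of `√(1 - M)`. -/
lemma Z_le (hP : P.IsProb) {c : ℝ} (hc : 0 < c) : P.Z ≤ c + (1 - P.M) / c := by
  have := hP.mean_mono (g := fun x => c + 1 / c + -1 / c * |x|) abs_sqrt_le_one
    (abs_affine_le (c + 1 / c) (-1 / c)) fun x hx => by
    have e : c + 1 / c + -1 / c * |x| = (c ^ 2 + (1 - |x|)) / c := by field_simp; ring
    change _ ≤ c + 1 / c + -1 / c * |x|
    rw [e]
    have h0 : 0 ≤ 1 - |x| := by linarith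
    refine Real.sqrt_le_iff.2 ⟨by positivity, ?_⟩
    rw [div_pow, le_div_iff₀ (by positivity), ← sq_abs x]
    nlinarith [sq_nonneg (c ^ 2 - (1 - |x|)), mul_nonneg (sq_nonneg c) h0, abs_nonneg x,
      mul_nonneg (sq_nonneg c) (sq_nonneg (1 - |x|))]
  rw [hP.mean_affine_abs] at this
  change P.Z ≤ _ at this
  refine this.trans_eq ?_
  field_simp; ring

end SymList.IsProb

lemma exists_H_le {ε : ℝ} (hε : 0 < ε) :
    ∃ c, 0 < c ∧ ∀ P : SymList.{u}, P.IsProb → P.H ≤ ε + c * (1 - P.M) := by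
  obtain ⟨c, hc, H⟩ := h_le_add_mul hε
  refine ⟨c / 2, by positivity, fun P hP => ?_⟩
  have := hP.mean_mono (g := fun x => ε + c / 2 + -(c / 2) * |x|) abs_biasEntropy_le_one
    (SymList.IsProb.abs_affine_le (ε + c / 2) (-(c / 2))) fun x hx => by
      have := H ((1 - |x|) / 2) (by linarith)
      change h _ ≤ _
      linarith
  rw [hP.mean_affine_abs] at this
  change P.H ≤ _ at this
  linarith

/-! ### The averaging operator and its powers -/

/-- The average of a functional over the two one-step transforms of a list. -/
def stepAvg : (SymList.{u} → ℝ) →ₗ[ℝ] (SymList.{u} → ℝ) where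
  toFun φ Q := (φ Q.minus + φ Q.plus) / 2
  map_add' φ ψ := by ext Q; simp only [Pi.add_apply]; ring
  map_smul' c φ := by ext Q; simp only [Pi.smul_apply, smul_eq_mul, RingHom.id_apply]; ring

/-- The indicator function of a set of lists. -/
def ind (S : Set SymList.{u}) : SymList.{u} → ℝ := S.indicator 1

lemma ind_nonneg (S : Set SymList.{u}) (Q : SymList.{u}) : 0 ≤ ind S Q :=
  Set.indicator_nonneg (fun _ _ => zero_le_one) Q

lemma ind_le_one (S : Set SymList.{u}) (Q : SymList.{u}) : ind S Q ≤ 1 :=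
  Set.indicator_le_self' (fun _ _ => zero_le_one) Q

lemma ind_of_mem {S : Set SymList.{u}} {Q : SymList.{u}} (h : Q ∈ S) : ind S Q = 1 :=
  Set.indicator_of_mem h _

lemma ind_of_notMem {S : Set SymList.{u}} {Q : SymList.{u}} (h : Q ∉ S) : ind S Q = 0 :=
  Set.indicator_of_notMem h _

lemma ind_le {S : Set SymList.{u}} {Q : SymList.{u}} {a : ℝ} (h0 : 0 ≤ a) (h1 : Q ∈ S → 1 ≤ a) :
    ind S Q ≤ a := by
  by_cases h : Q ∈ S
  · rw [ind_of_mem h]; exact h1 h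
  · rw [ind_of_notMem h]; exact h0

lemma stepAvg_apply (φ : SymList.{u} → ℝ) (Q : SymList.{u}) :
    stepAvg φ Q = (φ Q.minus + φ Q.plus) / 2 := rfl

lemma sum_iter (n : ℕ) (φ : SymList.{u} → ℝ) (P : SymList.{u}) :
    ∑ b : Fin n → Bool, φ (P.iter n b) = 2 ^ n * (stepAvg ^ n) φ P := by
  induction n generalizing φ with
  | zero => simp [SymList.iter]
  | succ n ih =>
    -- Split off the last bit, the one applied last by `iter`.
    rw [← (Fin.snocEquiv fun _ => Bool).sum_comp, Fintype.sum_prod_type_right]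
    have e (b : Fin n → Bool) :
        ∑ x, φ (P.iter (n + 1) (Fin.snocEquiv (fun _ => Bool) (x, b))) =
          2 * stepAvg φ (P.iter n b) := by
      simp [SymList.iter, SymList.step, stepAvg_apply, Fin.snocEquiv]
      ring
    rw [Finset.sum_congr rfl fun b _ => e b, ← Finset.mul_sum, ih, pow_succ stepAvg,
      Module.End.mul_apply]
    ring

/-- Turns counting of bit sequences into powers of a positive linear operator that fixes constants.
-/
lemma ncard_iter (n : ℕ) (S : Set SymList.{u}) (P : SymList.{u}) :
    (({b | P.iter n b ∈ S} : Set (Fin n → Bool)).ncard : ℝ) / 2 ^ n = (stepAvg ^ n) (ind S) P := by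
  classical
  rw [div_eq_iff (by positivity), mul_comm, ← sum_iter, Set.ncard_eq_toFinset_card',
    Finset.card_eq_sum_ones, Nat.cast_sum, Set.toFinset_ofPred, Finset.sum_filter]
  refine Finset.sum_congr rfl fun b _ => ?_
  simp [ind, Set.indicator_apply]

variable {P : SymList.{u}} {φ ψ : SymList.{u} → ℝ}

lemma stepAvg_mono (h : ∀ Q, Q.IsProb → φ Q ≤ ψ Q) (hP : P.IsProb) : stepAvg φ P ≤ stepAvg ψ P := by
  rw [stepAvg_apply, stepAvg_apply]
  linarith [h _ hP.minus, h _ hP.plus]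

lemma stepAvg_pow_mono (n : ℕ) (h : ∀ Q, Q.IsProb → φ Q ≤ ψ Q) (hP : P.IsProb) :
    (stepAvg ^ n) φ P ≤ (stepAvg ^ n) ψ P := by
  induction n generalizing P with
  | zero => exact h P hP
  | succ n ih =>
    rw [pow_succ', Module.End.mul_apply, Module.End.mul_apply]
    exact stepAvg_mono (fun Q hQ => ih hQ) hP

lemma stepAvg_pow_const (n : ℕ) (c : ℝ) (P : SymList.{u}) :
    (stepAvg ^ n) (fun _ => c) P = c := by
  induction n with
  | zero => rfl
  | succ n ih =>
    rw [pow_succ, Module.End.mul_apply, show stepAvg (fun _ => c) = fun _ => c from ?_, ih]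
    ext Q; rw [stepAvg_apply]; ring

lemma stepAvg_pow_add (n : ℕ) (φ ψ : SymList.{u} → ℝ) (P : SymList.{u}) :
    (stepAvg ^ n) (fun Q => φ Q + ψ Q) P = (stepAvg ^ n) φ P + (stepAvg ^ n) ψ P :=
  congrFun (map_add (stepAvg ^ n) φ ψ) P

lemma stepAvg_pow_mul (n : ℕ) (c : ℝ) (φ : SymList.{u} → ℝ) (P : SymList.{u}) :
    (stepAvg ^ n) (fun Q => c * φ Q) P = c * (stepAvg ^ n) φ P :=
  congrFun (map_smul (stepAvg ^ n) c φ) P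

lemma stepAvg_pow_ind_nonneg (n : ℕ) (S : Set SymList.{u}) (hP : P.IsProb) :
    0 ≤ (stepAvg ^ n) (ind S) P := by
  have := stepAvg_pow_mono n (fun Q _ => ind_nonneg S Q) hP
  rwa [stepAvg_pow_const] at this

lemma stepAvg_pow_ind_le_one (n : ℕ) (S : Set SymList.{u}) (hP : P.IsProb) :
    (stepAvg ^ n) (ind S) P ≤ 1 := by
  have := stepAvg_pow_mono n (fun Q _ => ind_le_one S Q) hP
  rwa [stepAvg_pow_const] at this

lemma stepAvg_pow_le_self (n : ℕ) (h : ∀ Q, Q.IsProb → stepAvg φ Q ≤ φ Q) (hP : P.IsProb) :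
    (stepAvg ^ n) φ P ≤ φ P := by
  induction n with
  | zero => exact le_rfl
  | succ n ih =>
    rw [pow_succ, Module.End.mul_apply]
    exact (stepAvg_pow_mono n h hP).trans ih

lemma stepAvg_M_le (hP : P.IsProb) : stepAvg SymList.M P ≤ P.M := by
  rw [stepAvg_apply, hP.M_minus]
  linarith [hP.M_plus_le]

lemma stepAvg_pow_H (n : ℕ) (hP : P.IsProb) : (stepAvg ^ n) SymList.H P = P.H := by
  induction n generalizing P with
  | zero => rfl
  | succ n ih =>
    rw [pow_succ', Module.End.mul_apply, stepAvg_apply, ih hP.minus, ih hP.plus]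
    linarith [hP.H_minus_add_H_plus]

/-! ### Polarization -/

/-- The potential is `1 - (1 - M)²`, increasing on `[0, 1]`, so `M⁺` may be replaced by its upper
bound `2M - M²`; the drop is then exactly `(M - M²)²`. -/
lemma stepAvg_two_mul_M_sub_sq_le (hP : P.IsProb) :
    stepAvg (fun Q => 2 * Q.M - Q.M ^ 2) P ≤
      (2 * P.M - P.M ^ 2) - (P.M - P.M ^ 2) ^ 2 := by
  rw [stepAvg_apply, hP.M_minus]
  have h0 := hP.M_nonneg
  have h1 := hP.M_le_one
  have h2 := hP.M_plus_le
  have h3 := hP.plus.M_nonneg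
  have h4 : (1 - (2 * P.M - P.M ^ 2)) ^ 2 ≤ (1 - P.plus.M) ^ 2 :=
    pow_le_pow_left₀ (by nlinarith [sq_nonneg (1 - P.M)]) (by linarith) 2
  nlinarith

lemma tendsto_stepAvg_pow_M_sub_sq (hP : P.IsProb) :
    Tendsto (fun n => (stepAvg ^ n) (fun Q => (Q.M - Q.M ^ 2) ^ 2) P) atTop (𝓝 0) := by
  set A : ℕ → ℝ := fun n => (stepAvg ^ n) (fun Q => 2 * Q.M - Q.M ^ 2) P with hA
  set D : ℕ → ℝ := fun n => (stepAvg ^ n) (fun Q => (Q.M - Q.M ^ 2) ^ 2) P with hD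
  have hD0 n : 0 ≤ D n := by
    have := stepAvg_pow_mono n (fun Q _ => sq_nonneg (Q.M - Q.M ^ 2)) hP
    rwa [stepAvg_pow_const] at this
  -- The dissipation is bounded by the increments of a decreasing, bounded sequence.
  have hAD n : D n ≤ A n - A (n + 1) := by
    have := stepAvg_pow_mono n (φ := fun Q => stepAvg (fun Q => 2 * Q.M - Q.M ^ 2) Q +
      (Q.M - Q.M ^ 2) ^ 2) (ψ := fun Q => 2 * Q.M - Q.M ^ 2)
      (fun Q hQ => by linarith [stepAvg_two_mul_M_sub_sq_le hQ]) hP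
    rw [stepAvg_pow_add] at this
    have e : A (n + 1) = (stepAvg ^ n) (stepAvg fun Q => 2 * Q.M - Q.M ^ 2) P := by
      rw [hA]; simp only [pow_succ, Module.End.mul_apply]
    change _ + D n ≤ A n at this
    rw [e]; linarith
  have hA0 n : 0 ≤ A n := by
    have := stepAvg_pow_mono n (φ := fun _ => 0) (ψ := fun Q => 2 * Q.M - Q.M ^ 2)
      (fun Q hQ => by nlinarith [hQ.M_nonneg, hQ.M_le_one]) hP
    rwa [stepAvg_pow_const] at this
  have hmono : Antitone A := antitone_nat_of_succ_le fun n => by linarith [hD0 n, hAD n]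
  have hlim := tendsto_atTop_ciInf hmono ⟨0, by rintro _ ⟨n, rfl⟩; exact hA0 n⟩
  have hdiff := hlim.sub (hlim.comp (tendsto_add_atTop_nat 1))
  rw [sub_self] at hdiff
  exact squeeze_zero hD0 hAD hdiff

lemma tendsto_stepAvg_pow_ind_mid (hP : P.IsProb) {ε δ : ℝ} (hε : 0 < ε) (hδ : 0 < δ) :
    Tendsto (fun n => (stepAvg ^ n) (ind {Q | ε ≤ Q.M ∧ Q.M ≤ 1 - δ}) P) atTop (𝓝 0) := by
  have h := (tendsto_stepAvg_pow_M_sub_sq hP).const_mul (((ε * δ) ^ 2)⁻¹)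
  rw [mul_zero] at h
  refine squeeze_zero (fun n => stepAvg_pow_ind_nonneg n _ hP) (fun n => ?_) h
  rw [← stepAvg_pow_mul]
  refine stepAvg_pow_mono n (fun Q hQ => ind_le (by positivity) fun hm => ?_) hP
  have hprod : ε * δ ≤ Q.M * (1 - Q.M) :=
    mul_le_mul hm.1 (by linarith [hm.2]) hδ.le hQ.M_nonneg
  rw [inv_mul_eq_div, one_le_div (by positivity), show Q.M - Q.M ^ 2 = Q.M * (1 - Q.M) by ring]
  exact pow_le_pow_left₀ (by positivity) hprod 2

/-! ### The rate of polarization -/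

/-- The first term is a supermartingale that is at least `1` once `Z ≥ 2^{-K}`, so it pays for
leaving the small region. The second is Markov's inequality for the `-s` moment of the exponent `X`:
inside that region `X` is multiplied by at least `1 - 1/K` or by `2`, each with probability `1/2`.
-/
lemma stepAvg_pow_ind_Z_gt_le {K s t : ℝ} (hK : 1 < K) (hs : 0 < s) (ht : 0 < t) (n : ℕ)
    (hP : P.IsProb) {X : ℝ} (hX : 0 < X) (hZ : P.Z ≤ 2 ^ (-X)) :
    (stepAvg ^ n) (ind {Q | (2 : ℝ) ^ (-t) < Q.Z}) P ≤
      2 ^ K * P.Z + (t / X) ^ s * (((1 - 1 / K) ^ (-s) + 2 ^ (-s)) / 2) ^ n := by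
  have hK0 : 0 < K := by linarith
  have hK1 : 0 < 1 - 1 / K := by rw [sub_pos, div_lt_one hK0]; exact hK
  have h2K : (0 : ℝ) < 2 ^ K := by positivity
  induction n generalizing P X with
  | zero =>
    rw [pow_zero, Module.End.one_apply, pow_zero, mul_one]
    have h0 : 0 ≤ (t / X) ^ s := by positivity
    have h1 : 0 ≤ 2 ^ K * P.Z := mul_nonneg h2K.le hP.Z_nonneg
    refine ind_le (by linarith) fun hm => ?_
    have h2 : (2 : ℝ) ^ (-t) < 2 ^ (-X) := lt_of_lt_of_le hm hZ
    rw [Real.rpow_lt_rpow_left_iff (by norm_num)] at h2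
    have h3 : 1 ≤ (t / X) ^ s :=
      Real.one_le_rpow (by rw [one_le_div hX]; linarith) hs.le
    linarith
  | succ n ih =>
    set ρ : ℝ := ((1 - 1 / K) ^ (-s) + 2 ^ (-s)) / 2 with hρ
    have hρ0 : 0 ≤ ρ := by positivity
    rcases le_or_gt ((2 : ℝ) ^ (-K)) P.Z with hbig | hsmall
    · refine (stepAvg_pow_ind_le_one _ _ hP).trans ?_
      have h1 : 1 ≤ 2 ^ K * P.Z := by
        calc (1 : ℝ) = 2 ^ K * 2 ^ (-K) := by
              rw [← Real.rpow_add (by norm_num), add_neg_cancel, Real.rpow_zero]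
          _ ≤ _ := mul_le_mul_of_nonneg_left hbig h2K.le
      have h0 : 0 ≤ (t / X) ^ s * ρ ^ (n + 1) := by positivity
      linarith
    -- Raise the exponent to at least `K`, so that the loss of `1` in a minus step is at most `W /
    -- K`.
    obtain ⟨W, hXW, hKW, hW⟩ : ∃ W, X ≤ W ∧ K ≤ W ∧ P.Z ≤ 2 ^ (-W) := by
      rcases le_total X K with h | h
      · exact ⟨K, h, le_rfl, hsmall.le⟩
      · exact ⟨X, le_rfl, h, hZ⟩
    have hW0 : 0 < W := by linarith
    have hZ0 := hP.Z_nonneg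
    have hZm := hP.Z_minus_add_sq_le
    have hV0 : 0 < (1 - 1 / K) * W := by positivity
    have hminus := ih hP.minus hV0 (by
      calc P.minus.Z ≤ 2 * P.Z := by linarith [sq_nonneg P.Z]
        _ ≤ 2 * 2 ^ (-W) := by linarith
        _ = 2 ^ (1 - W) := by
          rw [sub_eq_add_neg, Real.rpow_add (by norm_num), Real.rpow_one]
        _ ≤ 2 ^ (-((1 - 1 / K) * W)) := by
          rw [Real.rpow_le_rpow_left_iff (by norm_num)]
          have : 1 ≤ 1 / K * W := by rw [one_div_mul_eq_div, one_le_div hK0]; exact hKW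
          linarith)
    have hplus := ih hP.plus (X := 2 * W) (by positivity) (by
      rw [hP.Z_plus]
      calc P.Z ^ 2 ≤ (2 ^ (-W)) ^ 2 := pow_le_pow_left₀ hZ0 hW 2
        _ = 2 ^ (-(2 * W)) := by
          rw [← Real.rpow_natCast, ← Real.rpow_mul (by norm_num)]; congr 1; push_cast; ring)
    have e1 : (t / ((1 - 1 / K) * W)) ^ s = (t / W) ^ s * (1 - 1 / K) ^ (-s) := by
      rw [Real.rpow_neg hK1.le, ← Real.inv_rpow hK1.le, ← Real.mul_rpow (by positivity)
        (by positivity)]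
      congr 1; field_simp
    have e2 : (t / (2 * W)) ^ s = (t / W) ^ s * 2 ^ (-s) := by
      rw [Real.rpow_neg (by norm_num), ← Real.inv_rpow (by norm_num), ← Real.mul_rpow
        (by positivity) (by positivity)]
      congr 1; field_simp
    rw [e1] at hminus
    rw [e2, hP.Z_plus] at hplus
    have hXW' : (t / W) ^ s ≤ (t / X) ^ s := by gcongr
    rw [pow_succ', Module.End.mul_apply, stepAvg_apply]
    calc _ ≤ 2 ^ K * ((P.minus.Z + P.Z ^ 2) / 2) + (t / W) ^ s * ρ ^ (n + 1) := by
          have e : ρ ^ (n + 1) = ((1 - 1 / K) ^ (-s) + 2 ^ (-s)) / 2 * ρ ^ n := by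
            rw [← hρ, pow_succ']
          rw [e]; linarith
      _ ≤ _ := by gcongr; linarith

/-- As a function of `s` the left side is `1` at `0`, with derivative `(β - 1/2) log 2 < 0` there.
-/
lemma exists_rpow_mul_lt_one {β : ℝ} (hβ : β < 1 / 2) :
    ∃ s : ℝ, 0 < s ∧ (2 : ℝ) ^ (β * s) * ((1 + 2 ^ (-s)) / 2) < 1 := by
  have hl : 0 < Real.log 2 := Real.log_pos (by norm_num)
  set f : ℝ → ℝ := fun s =>
    (Real.exp (Real.log 2 * β * s) + Real.exp (Real.log 2 * (β - 1) * s)) / 2 with hf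
  have hd : HasDerivAt f ((Real.log 2 * β + Real.log 2 * (β - 1)) / 2) 0 := by
    have h1 (c : ℝ) : HasDerivAt (fun s => Real.exp (c * s)) c 0 := by
      simpa using ((hasDerivAt_id (0 : ℝ)).const_mul c).exp
    exact ((h1 _).add (h1 _)).div_const 2
  have hneg : (Real.log 2 * β + Real.log 2 * (β - 1)) / 2 < 0 := by nlinarith
  have hev := (hasDerivAt_iff_tendsto_slope.1 hd).eventually_lt_const hneg
  have hev' : ∀ᶠ s in 𝓝[>] (0 : ℝ), slope f 0 s < 0 :=
    hev.filter_mono (nhdsWithin_mono _ fun x hx => ne_of_gt hx)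
  obtain ⟨s, hs, hs0⟩ := (hev'.and self_mem_nhdsWithin).exists
  have hs0 : 0 < s := hs0
  refine ⟨s, hs0, ?_⟩
  rw [slope_def_field, sub_zero, div_lt_iff₀ hs0, zero_mul] at hs
  have hf0 : f 0 = 1 := by simp [hf]
  have e : f s = (2 : ℝ) ^ (β * s) * ((1 + 2 ^ (-s)) / 2) := by
    rw [hf, Real.rpow_def_of_pos (by norm_num), Real.rpow_def_of_pos (by norm_num), ← mul_div_assoc,
      mul_add, mul_one, ← Real.exp_add]
    ring_nf
  linarith

lemma exists_stepAvg_pow_ind_Z_gt_le {β : ℝ} (hβ : β < 1 / 2) :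
    ∃ C r : ℝ, 0 < C ∧ 0 ≤ r ∧ r < 1 ∧ ∀ (n : ℕ) (P : SymList.{u}), P.IsProb →
      (stepAvg ^ n) (ind {Q | (2 : ℝ) ^ (-(2 : ℝ) ^ ((n : ℝ) * β)) < Q.Z}) P ≤
        C * P.Z + r ^ n := by
  obtain ⟨s, hs, hlt⟩ := exists_rpow_mul_lt_one hβ
  -- Letting `K → ∞` recovers the strict inequality without the loss factor.
  have hK : ∃ K : ℝ, 1 < K ∧
      (2 : ℝ) ^ (β * s) * (((1 - 1 / K) ^ (-s) + 2 ^ (-s)) / 2) < 1 := by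
    have h1 : Tendsto (fun K : ℝ => 1 - 1 / K) atTop (𝓝 1) := by
      simpa using (tendsto_inv_atTop_zero (𝕜 := ℝ)).const_sub 1
    have h2 := h1.rpow_const (p := -s) (Or.inl one_ne_zero)
    rw [Real.one_rpow] at h2
    have h3 := ((h2.add_const ((2 : ℝ) ^ (-s))).div_const 2).const_mul ((2 : ℝ) ^ (β * s))
    exact ((eventually_gt_atTop 1).and (h3.eventually_lt_const hlt)).exists
  obtain ⟨K, hK1, hKlt⟩ := hK
  have hK0 : 0 < K := by linarith
  have hu : 0 < 1 - 1 / K := by rw [sub_pos, div_lt_one hK0]; exact hK1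
  refine ⟨2 ^ K, _, by positivity, by positivity, hKlt, fun n P hP => ?_⟩
  set ρ : ℝ := ((1 - 1 / K) ^ (-s) + 2 ^ (-s)) / 2
  have hρ0 : 0 ≤ ρ := by positivity
  rcases le_total P.Z (2 ^ (-K)) with h | h
  · refine (stepAvg_pow_ind_Z_gt_le hK1 hs (by positivity) n hP hK0 h).trans ?_
    have h1 : ((2 : ℝ) ^ ((n : ℝ) * β) / K) ^ s ≤ ((2 : ℝ) ^ (β * s)) ^ n := by
      have e : ((2 : ℝ) ^ (β * s)) ^ n = ((2 : ℝ) ^ ((n : ℝ) * β)) ^ s := by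
        rw [← Real.rpow_natCast, ← Real.rpow_mul (by norm_num), ← Real.rpow_mul (by norm_num)]
        congr 1; ring
      rw [e]
      exact Real.rpow_le_rpow (by positivity) (div_le_self (by positivity) hK1.le) hs.le
    rw [mul_pow]
    have := mul_le_mul_of_nonneg_right h1 (pow_nonneg hρ0 n)
    linarith
  · refine (stepAvg_pow_ind_le_one _ _ hP).trans ?_
    have h1 : 1 ≤ 2 ^ K * P.Z := by
      calc (1 : ℝ) = 2 ^ K * 2 ^ (-K) := by
            rw [← Real.rpow_add (by norm_num), add_neg_cancel, Real.rpow_zero]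
        _ ≤ _ := mul_le_mul_of_nonneg_left h (by positivity)
    have h0 : 0 ≤ ((2 : ℝ) ^ (β * s) * ρ) ^ n := by positivity
    linarith

lemma tendsto_stepAvg_pow_ind_slow (hP : P.IsProb) {β : ℝ} (hβ : β < 1 / 2) :
    Tendsto (fun n : ℕ => (stepAvg ^ n)
      (ind {Q | 1 / 2 < Q.M ∧ Q.M < 1 - (2 : ℝ) ^ (-(2 : ℝ) ^ ((n : ℝ) * β))}) P) atTop (𝓝 0) := by
  -- The slack between `β` and `γ` absorbs the `m` initial steps: `(m + k)β ≤ kγ` for large `k`.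
  obtain ⟨γ, hβγ, hγ⟩ := exists_between hβ
  obtain ⟨C, r, hC, hr0, hr1, hfast⟩ := exists_stepAvg_pow_ind_Z_gt_le.{u} hγ
  rw [Metric.tendsto_atTop]
  intro η hη
  -- With these choices a start at `M < δ` costs `2δ ≤ η/8`, and a start at `M > 1 - δ` costs `C Z ≤
  -- 2Cc = η/8` plus `r ^ k`.
  set c := η / (16 * C)
  have hc : 0 < c := by positivity
  set δ := min (η / 16) (c ^ 2)
  have hδ : 0 < δ := by positivity
  obtain ⟨m, hm⟩ := ((tendsto_stepAvg_pow_ind_mid hP hδ hδ).eventually_lt_const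
    (show 0 < η / 4 by positivity)).exists
  have hlin : ∀ᶠ k : ℕ in atTop, ((m + k : ℕ) : ℝ) * β ≤ k * γ := by
    filter_upwards [(tendsto_natCast_atTop_atTop (R := ℝ)).eventually_ge_atTop
      (m * β / (γ - β))] with k hk
    rw [div_le_iff₀ (by linarith)] at hk
    push_cast; linarith
  obtain ⟨N, hN⟩ := eventually_atTop.1 (hlin.and
    ((tendsto_pow_atTop_nhds_zero_of_lt_one hr0 hr1).eventually_lt_const
      (show 0 < η / 4 by positivity)))
  refine ⟨m + N, fun n hn => ?_⟩
  obtain ⟨k, rfl⟩ := Nat.exists_eq_add_of_le (le_of_add_le_left hn)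
  obtain ⟨hk, hrk⟩ := hN k (by omega)
  rw [Real.dist_eq, sub_zero, abs_of_nonneg (stepAvg_pow_ind_nonneg _ _ hP)]
  set B : Set SymList.{u} :=
    {Q | 1 / 2 < Q.M ∧ Q.M < 1 - (2 : ℝ) ^ (-(2 : ℝ) ^ (((m + k : ℕ) : ℝ) * β))}
  have key : ∀ Q : SymList.{u}, Q.IsProb → (stepAvg ^ k) (ind B) Q ≤
      ind {Q | δ ≤ Q.M ∧ Q.M ≤ 1 - δ} Q + (η / 4 + r ^ k) := by
    intro Q hQ
    have hrk0 : 0 ≤ r ^ k := pow_nonneg hr0 k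
    have hi := ind_nonneg {Q | δ ≤ Q.M ∧ Q.M ≤ 1 - δ} Q
    rcases lt_or_ge Q.M δ with h1 | h1
    · have h2 : (stepAvg ^ k) (ind B) Q ≤ 2 * Q.M := by
        refine (stepAvg_pow_mono k (ψ := fun Q => 2 * Q.M) (fun R hR => ind_le
          (by linarith [hR.M_nonneg]) fun hm => by linarith [hm.1]) hQ).trans ?_
        rw [stepAvg_pow_mul k 2 SymList.M]
        linarith [stepAvg_pow_le_self k (fun R => stepAvg_M_le) hQ]
      linarith [min_le_left (η / 16) (c ^ 2)]
    rcases le_or_gt Q.M (1 - δ) with h2 | h2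
    · rw [ind_of_mem (show Q ∈ {Q : SymList.{u} | δ ≤ Q.M ∧ Q.M ≤ 1 - δ} from ⟨h1, h2⟩)]
      linarith [stepAvg_pow_ind_le_one k B hQ]
    · have h3 : (stepAvg ^ k) (ind B) Q ≤ C * Q.Z + r ^ k := by
        refine (stepAvg_pow_mono k (fun R hR => ind_le (ind_nonneg _ _) fun hm => ?_) hQ).trans
          (hfast k Q hQ)
        refine (ind_of_mem ?_).ge
        have h4 : (2 : ℝ) ^ (-(2 : ℝ) ^ ((k : ℝ) * γ)) ≤
            2 ^ (-(2 : ℝ) ^ (((m + k : ℕ) : ℝ) * β)) := by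
          rw [Real.rpow_le_rpow_left_iff (by norm_num), neg_le_neg_iff,
            Real.rpow_le_rpow_left_iff (by norm_num)]
          exact hk
        change _ < R.Z
        linarith [hm.2, hR.one_sub_M_le_Z]
      have h5 : (1 - Q.M) / c ≤ c := by
        rw [div_le_iff₀ hc, ← sq]
        linarith [min_le_right (η / 16) (c ^ 2)]
      have h6 : C * Q.Z ≤ C * (2 * c) :=
        mul_le_mul_of_nonneg_left (by linarith [hQ.Z_le hc]) hC.le
      have h7 : C * (2 * c) = η / 8 := by simp only [c]; field_simp; norm_num
      linarith
  have := stepAvg_pow_mono m key hP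
  rw [stepAvg_pow_add, stepAvg_pow_const] at this
  rw [pow_add, Module.End.mul_apply]
  linarith

/-! ### The source list and the limiting fractions -/

lemma isProb_sourceList {Y : Type u} (p : PMF (Bool × Y)) : (sourceList p).IsProb where
  nonneg y := by
    change 0 ≤ probY p y
    exact Finset.sum_nonneg fun _ _ => ENNReal.toReal_nonneg
  hasSum := by
    have h : HasSum (fun v : Bool × Y => (p v).toReal) 1 := by
      have := ENNReal.hasSum_toReal (f := p) (by rw [p.tsum_coe]; simp)
      rwa [← ENNReal.tsum_toReal_eq (fun v => p.apply_ne_top v), p.tsum_coe,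
        ENNReal.toReal_one] at this
    have hx (x : Bool) : Summable fun y => (p (x, y)).toReal :=
      h.summable.comp_injective (Prod.mk_right_injective x)
    have h2 := hasSum_bool_prod (F := fun v => (p v).toReal) (hx false).hasSum (hx true).hasSum
    rw [h.unique h2, add_comm]
    have e : (sourceList p).μ = fun y => (p (true, y)).toReal + (p (false, y)).toReal := by
      funext y
      change probY p y = _
      simp [probY]
    rw [e]
    exact (hx true).hasSum.add (hx false).hasSum
  abs_le y := by
    have h0 : 0 ≤ (p (false, y)).toReal := ENNReal.toReal_nonneg
    have h1 : 0 ≤ (p (true, y)).toReal := ENNReal.toReal_nonneg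
    have e : probY p y = (p (true, y)).toReal + (p (false, y)).toReal := by simp [probY]
    change |(p (false, y)).toReal / probY p y - (p (true, y)).toReal / probY p y| ≤ 1
    rw [← sub_div, abs_div, e]
    refine div_le_one_of_le₀ ?_ (abs_nonneg _)
    rw [abs_of_nonneg (add_nonneg h1 h0), abs_le]
    constructor <;> linarith


lemma tendsto_of_forall_abs_sub_le {x : ℕ → ℝ} {a : ℝ}
    (h : ∀ ε > 0, ∃ y : ℕ → ℝ, Tendsto y atTop (𝓝 0) ∧ ∀ n, |x n - a| ≤ ε + y n) :
    Tendsto x atTop (𝓝 a) := by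
  rw [Metric.tendsto_atTop]
  intro ε hε
  obtain ⟨y, hy, hxy⟩ := h (ε / 2) (by positivity)
  obtain ⟨N, hN⟩ := eventually_atTop.1 (hy.eventually_lt_const (show 0 < ε / 2 by positivity))
  refine ⟨N, fun n hn => ?_⟩
  rw [Real.dist_eq]
  linarith [hxy n, hN n hn]

variable {β : ℝ}

/-- The lists `Q` with `M(Q) ≥ 1 - 2^{-2^{nβ}}`. -/
def lowSet (β : ℝ) (n : ℕ) : Set SymList.{u} :=
  {Q | 1 - (2 : ℝ) ^ (-(2 : ℝ) ^ ((n : ℝ) * β)) ≤ Q.M}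

/-- The lists `Q` with `M(Q) < 1 - 2^{-2^{nβ}}`. -/
def highSet (β : ℝ) (n : ℕ) : Set SymList.{u} :=
  {Q | Q.M < 1 - (2 : ℝ) ^ (-(2 : ℝ) ^ ((n : ℝ) * β))}

lemma notMem_highSet {n : ℕ} {Q : SymList.{u}} : Q ∉ highSet β n ↔ Q ∈ lowSet β n := by
  simp [lowSet, highSet]

/-- Since `β ≥ 0`, the threshold is at least `1/2`, while `H ≥ ε` keeps `M` away from `1`; such
lists are unpolarized. -/
lemma tendsto_lowSet_inter (hP : P.IsProb) (hβ0 : 0 ≤ β) {ε : ℝ} (hε : 0 < ε) :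
    Tendsto (fun n => (stepAvg ^ n) (ind {Q | Q ∈ lowSet β n ∧ ε ≤ Q.H}) P) atTop (𝓝 0) := by
  obtain ⟨c, hc, hH⟩ := exists_H_le.{u} (half_pos hε)
  refine squeeze_zero (fun n => stepAvg_pow_ind_nonneg n _ hP) (fun n => ?_)
    (tendsto_stepAvg_pow_ind_mid hP one_half_pos (show 0 < ε / (2 * c) by positivity))
  refine stepAvg_pow_mono n (fun Q hQ => ind_le (ind_nonneg _ _) fun hm => ?_) hP
  refine (ind_of_mem ?_).ge
  refine ⟨?_, ?_⟩
  · have h1 : (1 : ℝ) ≤ 2 ^ ((n : ℝ) * β) := Real.one_le_rpow (by norm_num) (by positivity)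
    have h2 : (2 : ℝ) ^ (-(2 : ℝ) ^ ((n : ℝ) * β)) ≤ 2 ^ (-1 : ℝ) :=
      (Real.rpow_le_rpow_left_iff (by norm_num)).2 (by linarith)
    rw [Real.rpow_neg_one] at h2
    have h3 : _ ≤ Q.M := hm.1
    linarith
  · have h1 : ε / 2 ≤ c * (1 - Q.M) := by linarith [hH Q hQ, hm.2]
    have h2 : ε / (2 * c) ≤ 1 - Q.M := by rw [div_le_iff₀ (by positivity)]; linarith
    linarith

/-- Either `M > 1/2` and the list polarizes too slowly, or `1 - M ≤ H ≤ 1 - ε` forces `ε ≤ M ≤ 1/2`.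
-/
lemma tendsto_highSet_inter (hP : P.IsProb) (hβ : β < 1 / 2) {ε : ℝ} (hε : 0 < ε) :
    Tendsto (fun n => (stepAvg ^ n) (ind {Q | Q ∈ highSet β n ∧ Q.H ≤ 1 - ε}) P) atTop (𝓝 0) := by
  have h := (tendsto_stepAvg_pow_ind_slow hP hβ).add
    (tendsto_stepAvg_pow_ind_mid hP hε (one_half_pos (α := ℝ)))
  rw [add_zero] at h
  refine squeeze_zero (fun n => stepAvg_pow_ind_nonneg n _ hP) (fun n => ?_) h
  rw [← stepAvg_pow_add]
  refine stepAvg_pow_mono n (fun Q hQ => ind_le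
    (add_nonneg (ind_nonneg _ _) (ind_nonneg _ _)) fun hm => ?_) hP
  rcases lt_or_ge (1 / 2) Q.M with h1 | h1
  · refine le_add_of_le_of_nonneg (ind_of_mem ?_).ge (ind_nonneg _ _)
    exact ⟨h1, hm.1⟩
  · refine le_add_of_nonneg_of_le (ind_nonneg _ _) (ind_of_mem ?_).ge
    exact ⟨by linarith [hQ.one_sub_M_le_H, hm.2], by linarith⟩

lemma tendsto_highSet (hP : P.IsProb) (hβ0 : 0 ≤ β) (hβ : β < 1 / 2) :
    Tendsto (fun n => (stepAvg ^ n) (ind (highSet β n)) P) atTop (𝓝 P.H) := by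
  refine tendsto_of_forall_abs_sub_le fun ε hε => ⟨_, ((tendsto_lowSet_inter hP hβ0 hε).add
    (tendsto_highSet_inter hP hβ hε)).trans (by rw [add_zero]), fun n => ?_⟩
  have hlow := stepAvg_pow_ind_nonneg n {Q | Q ∈ lowSet β n ∧ ε ≤ Q.H} hP
  have hhigh := stepAvg_pow_ind_nonneg n {Q | Q ∈ highSet β n ∧ Q.H ≤ 1 - ε} hP
  -- `h1` and `h2` compare `H` with the indicator from both sides, up to `ε` and the exceptional
  -- sets; the mean of `H` does not depend on `n`.
  have h1 := stepAvg_pow_mono n (φ := SymList.H) (ψ := fun Q => ind (highSet β n) Q +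
    (ind {Q | Q ∈ lowSet β n ∧ ε ≤ Q.H} Q + ε)) (fun Q hQ => by
      have a1 := ind_nonneg {Q | Q ∈ lowSet β n ∧ ε ≤ Q.H} Q
      have a2 := ind_nonneg (highSet β n) Q
      have a3 := hQ.H_le_one
      by_cases hm : Q ∈ highSet β n
      · linarith [ind_of_mem hm]
      · rcases le_or_gt ε Q.H with he | he
        · linarith [ind_of_mem (show Q ∈ {Q | Q ∈ lowSet β n ∧ ε ≤ Q.H} from
            ⟨notMem_highSet.1 hm, he⟩)]
        · linarith) hP
  have h2 := stepAvg_pow_mono n (φ := ind (highSet β n)) (ψ := fun Q => Q.H +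
    (ind {Q | Q ∈ highSet β n ∧ Q.H ≤ 1 - ε} Q + ε)) (fun Q hQ => by
      have a1 := ind_nonneg {Q | Q ∈ highSet β n ∧ Q.H ≤ 1 - ε} Q
      have a3 := hQ.H_nonneg
      refine ind_le (by linarith) fun hm => ?_
      rcases le_or_gt Q.H (1 - ε) with he | he
      · linarith [ind_of_mem (show Q ∈ {Q | Q ∈ highSet β n ∧ Q.H ≤ 1 - ε} from ⟨hm, he⟩)]
      · linarith) hP
  rw [stepAvg_pow_add, stepAvg_pow_add, stepAvg_pow_const, stepAvg_pow_H n hP] at h1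
  rw [stepAvg_pow_add, stepAvg_pow_add, stepAvg_pow_const] at h2
  change _ ≤ (stepAvg ^ n) SymList.H P + _ at h2
  rw [stepAvg_pow_H n hP] at h2
  rw [abs_le]
  constructor <;> linarith

lemma ind_lowSet (β : ℝ) (n : ℕ) :
    ind (lowSet.{u} β n) = fun Q => 1 + -1 * ind (highSet β n) Q := by
  ext Q
  by_cases hm : Q ∈ highSet β n
  · rw [ind_of_mem hm, ind_of_notMem fun h => notMem_highSet.2 h hm]; ring
  · rw [ind_of_notMem hm, ind_of_mem (notMem_highSet.1 hm)]; ring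

lemma tendsto_lowSet (hP : P.IsProb) (hβ0 : 0 ≤ β) (hβ : β < 1 / 2) :
    Tendsto (fun n => (stepAvg ^ n) (ind (lowSet β n)) P) atTop (𝓝 (1 - P.H)) := by
  refine ((tendsto_highSet hP hβ0 hβ).const_sub 1).congr fun n => ?_
  rw [ind_lowSet, stepAvg_pow_add, stepAvg_pow_const, stepAvg_pow_mul]
  ring

end PolarM

end

theorem lemma4 {Y : Type*} (p : PMF (Bool × Y)) (β : ℝ) (hβ0 : 0 ≤ β) (hβ : β < 1 / 2) :
    Tendsto (fun n : ℕ => ((PolarM.I0 p β n).ncard : ℝ) / 2 ^ n) atTop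
        (𝓝 (1 - PolarM.condEntropy p)) ∧
      Tendsto (fun n : ℕ => ((PolarM.I1 p β n).ncard : ℝ) / 2 ^ n) atTop
        (𝓝 (PolarM.condEntropy p)) ∧
      (∀ ε : ℝ, 0 < ε →
        Tendsto (fun n : ℕ =>
            (({b ∈ PolarM.I0 p β n | ε ≤ ((PolarM.sourceList p).iter n b).H}).ncard : ℝ) / 2 ^ n)
          atTop (𝓝 0)) ∧
      (∀ ε : ℝ, 0 < ε →
        Tendsto (fun n : ℕ =>
            (({b ∈ PolarM.I1 p β n | ((PolarM.sourceList p).iter n b).H ≤ 1 - ε}).ncard : ℝ) /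
              2 ^ n)
          atTop (𝓝 0)) := by
  have hP := PolarM.isProb_sourceList p
  refine ⟨?_, ?_, fun ε hε => ?_, fun ε hε => ?_⟩
  · exact (PolarM.tendsto_lowSet hP hβ0 hβ).congr fun n =>
      (PolarM.ncard_iter n (PolarM.lowSet β n) (PolarM.sourceList p)).symm
  · exact (PolarM.tendsto_highSet hP hβ0 hβ).congr fun n =>
      (PolarM.ncard_iter n (PolarM.highSet β n) (PolarM.sourceList p)).symm
  · exact (PolarM.tendsto_lowSet_inter hP hβ0 hε).congr fun n =>
      (PolarM.ncard_iter n ({Q | Q ∈ PolarM.lowSet β n ∧ ε ≤ Q.H}) (PolarM.sourceList p)).symm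
  · exact (PolarM.tendsto_highSet_inter hP hβ hε).congr fun n =>
      (PolarM.ncard_iter n ({Q | Q ∈ PolarM.highSet β n ∧ Q.H ≤ 1 - ε}) (PolarM.sourceList p)).symm
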